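/- Let $E$ be a finite-dimensional real inner product space, let $\mathcal M\subseteq U\subseteq E$ with $U$ open, and let $\xi$ be a random element of a measurable space $\Xi$ with law $P$. Let $\widetilde F,\widetilde G$ be real functions of $(\tau,\xi)$ that are measurable in $\xi$ for each $\tau\in U$ and locally Lipschitz in $\tau$ on $U$ for each $\xi$. Consider the stochastic problem of minimizing $\mathbb E[\widetilde F(\tau,\xi)]$ over $\tau\in\mathcal M$ subject to $\mathbb E[\widetilde G(\tau,\xi)]=0$ (for $\tau=(\Lambda,\alpha,\kappa)$ with slack $\kappa$, the constraint function is $\widetilde G(\Lambda,\alpha,\xi)+\kappa$), and let $[\mu_{\min},\mu_{\max}]$ be a bounded interval of multipliers. Put $$\widetilde{\mathcal L}(\tau,\xi,\mu)=\widetilde F(\tau,\xi)+\mu\,\widetilde G(\tau,\xi),\qquad Q(\tau,\xi)=\{\mu\in[\mu_{\min},\mu_{\max}]:\ 0\in\partial^c\widetilde{\mathcal L}(\tau,\xi,\mu),\ \tau\in\mathcal M\},$$ $$\Phi(\tau,\xi)=\mathrm{conv}\bigcup_{\mu\in Q(\tau,\xi)}\partial^c\widetilde{\mathcal L}(\tau,\xi,\mu),$$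 where $\partial^c$ is the Clarke subdifferential with respect to $\tau$. Let $\mathcal N_{\mathcal M}(\tau)$ be the (Clarke) normal cone of $\mathcal M$ at $\tau$; for convex $\mathcal M$ it is the usual normal cone. Let $\mathbb E[\Phi(\tau,\xi)]$ be the Aumann expectation, that is, the set of the expectations of all $P$-integrable selections of $\Phi(\tau,\cdot)$. Let $\xi^1,\xi^2,\dots$ be i.i.d. samples of $\xi$, and let $\Phi_N(\tau)=\frac1N\sum_{i=1}^N\Phi(\tau,\xi^i)$ (Minkowski average). Almost surely, for every $N\ge1$ let $\tau_N$ be a generalized KKT point of the sample-average problem, that is, $\tau_N\in\mathcal M$ and $$0\in\Phi_N(\tau_N)+\mathcal N_{\mathcal M}(\tau_N).$$ Then, almost surely, every accumulation point $\tau^*\in\mathcal M$ of the sequence $(\tau_N)$ satisfies the weak generalized KKT condition of the true problem: $$0\in\mathbb E[\Phi(\tau^*,\xi)]+\mathcal N_{\mathcal M}(\tau^*).$$ -/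

import Mathlib

open MeasureTheory ProbabilityTheory Filter Topology Set
open scoped Pointwise

noncomputable section

namespace OuterLoop

variable {E : Type*} [NormedAddCommGroup E] [InnerProductSpace ℝ E]

/-- Clarke's generalized directional derivative of `f` at `x` in direction `v`:
`f°(x; v) = limsup_{y → x, t ↓ 0} (f (y + t v) - f y) / t`.  It takes values in the extended
reals, so that the upper limit never has a junk value. -/
def clarkeDeriv (f : E → ℝ) (x v : E) : EReal :=
  limsup (fun p : E × ℝ => (((f (p.1 + p.2 • v) - f p.1) / p.2 : ℝ) : EReal))
    (𝓝 x ×ˢ 𝓝[>] (0 : ℝ))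

/-- Clarke's subdifferential `∂ᶜ f (x) = {g | ∀ v, ⟨g, v⟩ ≤ f°(x; v)}`. -/
def clarkeSubdiff (f : E → ℝ) (x : E) : Set E :=
  {g | ∀ v : E, ((inner ℝ g v : ℝ) : EReal) ≤ clarkeDeriv f x v}

/-- Clarke's tangent cone of `M` at `x`: the directions `v` such that for all sequences `xₖ → x`
in `M` and `tₖ ↓ 0` there are `vₖ → v` with `xₖ + tₖ vₖ ∈ M`. -/
def clarkeTangentCone (M : Set E) (x : E) : Set E :=
  {v | ∀ (y : ℕ → E) (t : ℕ → ℝ), (∀ k, y k ∈ M) → Tendsto y atTop (𝓝 x) →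
    Tendsto t atTop (𝓝[>] (0 : ℝ)) →
    ∃ w : ℕ → E, Tendsto w atTop (𝓝 v) ∧ ∀ᶠ k in atTop, y k + t k • w k ∈ M}

/-- The normal cone of `M` at `x`: the polar of the Clarke tangent cone.  For a convex set it is
the normal cone `{n | ∀ y ∈ M, ⟨n, y - x⟩ ≤ 0}` of convex analysis. -/
def normalCone (M : Set E) (x : E) : Set E :=
  {n | ∀ v ∈ clarkeTangentCone M x, inner ℝ n v ≤ 0}

/-- The expectation of a random set `S` under the law `P` (Aumann integral): the expectations of
its integrable selections. -/
def setExpectation {Ξ : Type*} [MeasurableSpace Ξ] (P : Measure Ξ) (S : Ξ → Set E) : Set E :=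
  {x | ∃ φ : Ξ → E, Integrable φ P ∧ (∀ᵐ z ∂P, φ z ∈ S z) ∧ ∫ z, φ z ∂P = x}

section Problem

variable {Ξ : Type*}

/-- The random Lagrangian `L(τ, ξ, μ) = F(τ, ξ) + μ G(τ, ξ)` of the problem
`min E[F(τ, ξ)]` subject to `E[G(τ, ξ)] = 0`, `τ ∈ M`.  (A slack variable that turns an inequality
into an equality is one of the coordinates of `τ`.) -/
def lagrangian (F G : E → Ξ → ℝ) (τ : E) (z : Ξ) (μ : ℝ) : ℝ :=
  F τ z + μ * G τ z

/-- The Clarke subdifferential of the Lagrangian with respect to `τ`. -/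
def lagrangianSubdiff (F G : E → Ξ → ℝ) (τ : E) (z : Ξ) (μ : ℝ) : Set E :=
  clarkeSubdiff (fun σ => lagrangian F G σ z μ) τ

/-- The admissible multipliers
`Q(τ, ξ) = {μ ∈ [μmin, μmax] | 0 ∈ ∂ᶜ L(τ, ξ, μ), τ ∈ M}`. -/
def multipliers (F G : E → Ξ → ℝ) (M : Set E) (μmin μmax : ℝ) (τ : E) (z : Ξ) : Set ℝ :=
  {μ | μ ∈ Icc μmin μmax ∧ (0 : E) ∈ lagrangianSubdiff F G τ z μ ∧ τ ∈ M}

/-- The stochastic generalized KKT map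
`Φ(τ, ξ) = conv (⋃ μ ∈ Q(τ, ξ), ∂ᶜ L(τ, ξ, μ))`. -/
def kktMap (F G : E → Ξ → ℝ) (M : Set E) (μmin μmax : ℝ) (τ : E) (z : Ξ) : Set E :=
  convexHull ℝ (⋃ μ ∈ multipliers F G M μmin μmax τ z, lagrangianSubdiff F G τ z μ)

/-- The sample-average map `Φ_N(τ) = (1 / N) ∑ Φ(τ, ξⁱ)`, a Minkowski average over the first `N`
terms of the sample sequence `s`. -/
def saaKKTMap (F G : E → Ξ → ℝ) (M : Set E) (μmin μmax : ℝ) (s : ℕ → Ξ) (N : ℕ) (τ : E) : Set E :=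
  (N : ℝ)⁻¹ • ∑ i ∈ Finset.range N, kktMap F G M μmin μmax τ (s i)

/-- `τ` is a generalized KKT point of the sample-average problem with the first `N` samples:
`τ ∈ M` and `0 ∈ Φ_N(τ) + N_M(τ)`. -/
def IsSAAKKTPoint (F G : E → Ξ → ℝ) (M : Set E) (μmin μmax : ℝ) (s : ℕ → Ξ) (N : ℕ) (τ : E) :
    Prop :=
  τ ∈ M ∧ (0 : E) ∈ saaKKTMap F G M μmin μmax s N τ + normalCone M τ

/-- `τ` satisfies the weak generalized KKT condition of the true problem:
`τ ∈ M` and `0 ∈ E[Φ(τ, ξ)] + N_M(τ)`, where `ξ` has law `P`. -/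
def IsWeakKKTPoint [MeasurableSpace Ξ] (P : Measure Ξ) (F G : E → Ξ → ℝ) (M : Set E)
    (μmin μmax : ℝ) (τ : E) : Prop :=
  τ ∈ M ∧ (0 : E) ∈ setExpectation P (kktMap F G M μmin μmax τ) + normalCone M τ

end Problem

end OuterLoop

end

namespace OuterLoop

/-! Admissible multipliers already make 0 a subgradient, so `kktMap` contains 0 as soon as it is
nonempty. The weak KKT condition at `τ*` therefore follows, with zero selection and zero normal,
once `multipliers` is nonempty at `τ*` for almost every sample. A sample with no multiplier at `τ*`
has a robust certificate: by compactness of `[μmin, μmax]`, finitely many directions from a dense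
sequence give uniform descent near `τ*` for all multipliers (`exists_mem_descentSamples`).
Certificates are countably many and measurable, and each one excludes multipliers on a whole
neighbourhood. One of positive probability is almost surely met by some sample, and then the points
`τ N` with large `N` cannot enter that neighbourhood. Hence all certificates around `τ*` are null.
-/

/-- A property that is measurable at each point, and closed in the parameter, defines a measurable
set when it is required for all parameters of a set. -/
theorem measurableSet_forall_mem_of_closed {X Ξ : Type*} [TopologicalSpace X]
    [SecondCountableTopology X] [MeasurableSpace Ξ] (O : Set X) (p : X → Ξ → Prop)
    (hclosed : ∀ z, IsClosed {x : O | p x z}) (hmeas : ∀ x ∈ O, MeasurableSet {z | p x z}) :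
    MeasurableSet {z | ∀ x ∈ O, p x z} := by
  obtain ⟨D, hDc, hDd⟩ := TopologicalSpace.exists_countable_dense O
  have h : {z | ∀ x ∈ O, p x z} = ⋂ x ∈ D, {z | p (x : X) z} := by
    ext z
    simp only [mem_ofPred_eq, mem_iInter]
    refine ⟨fun h x _ => h x x.2, fun h x hx => ?_⟩
    have hsub : closure D ⊆ {x : O | p x z} := (hclosed z).closure_subset_iff.2 h
    exact hsub (hDd ⟨x, hx⟩)
  rw [h]
  exact MeasurableSet.biInter hDc fun x _ => hmeas x x.2

/-! ### Uniform descent as a certificate against stationarity. -/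

section Descent

variable {E : Type*} [NormedAddCommGroup E] [InnerProductSpace ℝ E] {Ξ : Type*}

/-- The function `f` decreases along `v` at rate `δ`, for step sizes up to `δ` and at the points
of `B`, as long as the segment ends lie in `U`. -/
def DescentOn (f : E → ℝ) (U B : Set E) (δ : ℝ) (v : E) : Prop :=
  ∀ p : E × ℝ, p ∈ {p : E × ℝ | p.1 ∈ B ∩ U ∧ p.2 ∈ Ioo 0 δ ∧ p.1 + p.2 • v ∈ U} →
    f (p.1 + p.2 • v) - f p.1 ≤ -(δ * p.2)

theorem DescentOn.mono {f : E → ℝ} {U B B' : Set E} {δ δ' : ℝ} {v : E}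
    (h : DescentOn f U B δ v) (hB : B' ⊆ B) (hδ : δ' ≤ δ) : DescentOn f U B' δ' v := by
  rintro p ⟨h1, h2, h3⟩
  have := h p ⟨⟨hB h1.1, h1.2⟩, ⟨h2.1, h2.2.trans_le hδ⟩, h3⟩
  have := mul_le_mul_of_nonneg_right hδ h2.1.le
  linarith

/-- Descent bounds the Clarke derivative along `v` by `-δ < 0`. This works at every point of `B ∩
U`, so one certificate serves `τ*` and the nearby `τ N` alike. -/
theorem zero_notMem_clarkeSubdiff_of_descentOn {f : E → ℝ} {U B : Set E} {δ : ℝ} {v x : E}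
    (hU : IsOpen U) (hB : IsOpen B) (hx : x ∈ B ∩ U) (hδ : 0 < δ) (h : DescentOn f U B δ v) :
    (0 : E) ∉ clarkeSubdiff f x := by
  intro h0
  have h1 : ((inner ℝ (0 : E) v : ℝ) : EReal) ≤ clarkeDeriv f x v := h0 v
  have h2 : clarkeDeriv f x v ≤ ((-δ : ℝ) : EReal) := by
    refine limsup_le_of_le (by isBoundedDefault) ?_
    have e1 : ∀ᶠ p : E × ℝ in 𝓝 x ×ˢ 𝓝[>] (0 : ℝ), p.1 ∈ B ∩ U :=
      tendsto_fst.eventually ((hB.inter hU).mem_nhds hx)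
    have e2 : ∀ᶠ p : E × ℝ in 𝓝 x ×ˢ 𝓝[>] (0 : ℝ), p.2 ∈ Ioo 0 δ :=
      tendsto_snd.eventually (Ioo_mem_nhdsGT hδ)
    have e3 : ∀ᶠ p : E × ℝ in 𝓝 x ×ˢ 𝓝[>] (0 : ℝ), p.1 + p.2 • v ∈ U := by
      have hc : Tendsto (fun p : E × ℝ => p.1 + p.2 • v) (𝓝 (x, 0)) (𝓝 x) := by
        have : Continuous fun p : E × ℝ => p.1 + p.2 • v := by fun_prop
        simpa using this.tendsto (x, (0 : ℝ))
      have hle : 𝓝 x ×ˢ 𝓝[>] (0 : ℝ) ≤ 𝓝 (x, (0 : ℝ)) := by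
        rw [nhds_prod_eq]
        exact Filter.prod_mono le_rfl nhdsWithin_le_nhds
      exact (hc.mono_left hle).eventually (hU.mem_nhds hx.2)
    filter_upwards [e1, e2, e3] with p h1 h2 h3
    rw [EReal.coe_le_coe_iff, div_le_iff₀ h2.1]
    linarith [h p ⟨h1, h2, h3⟩]
  have h3 := h1.trans h2
  rw [EReal.coe_le_coe_iff, inner_zero_left] at h3
  linarith

theorem exists_descentOn_of_clarkeDeriv_neg {f : E → ℝ} {x v : E} (U : Set E)
    (h : clarkeDeriv f x v < 0) : ∃ δ > 0, ∃ B ∈ 𝓝 x, DescentOn f U B δ v := by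
  obtain ⟨a, ha, ha0⟩ := EReal.lt_iff_exists_real_btwn.1 h
  have ha0 : a < 0 := by exact_mod_cast ha0
  have hev := eventually_lt_of_limsup_lt ha
  obtain ⟨B, hB, T, hT, hBT⟩ := mem_prod_iff.1 hev
  obtain ⟨η, hη, hηT⟩ := mem_nhdsGT_iff_exists_Ioo_subset.1 hT
  -- One number bounds both the step size (by `η`) and the rate (by `-a`).
  refine ⟨min η (-a), lt_min hη (by linarith), B, hB, ?_⟩
  rintro p ⟨h1, h2, -⟩
  have hp : p ∈ B ×ˢ T := ⟨h1.1, hηT ⟨h2.1, h2.2.trans_le (min_le_left _ _)⟩⟩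
  have hq := hBT hp
  simp only [mem_ofPred_eq, EReal.coe_lt_coe_iff] at hq
  rw [div_lt_iff₀ h2.1] at hq
  have := mul_le_mul_of_nonneg_right (min_le_right η (-a)) h2.1.le
  linarith

/-- Descent of the Lagrangian persists, at a smaller rate, for nearby directions and multipliers. -/
theorem exists_descentOn_lagrangian_nhds {F G : E → Ξ → ℝ} {U : Set E} (hU : IsOpen U) {z : Ξ}
    (hF : LocallyLipschitzOn U fun τ => F τ z) (hG : LocallyLipschitzOn U fun τ => G τ z)
    {D : Set E} (hD : Dense D) {τ : E} (hτ : τ ∈ U) {μ : ℝ}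
    (h : (0 : E) ∉ lagrangianSubdiff F G τ z μ) :
    ∃ v ∈ D, ∃ δ > 0, ∃ B ∈ 𝓝 τ, ∃ S ∈ 𝓝 μ, ∀ ν ∈ S,
      DescentOn (fun σ => lagrangian F G σ z ν) U B δ v := by
  simp only [lagrangianSubdiff, clarkeSubdiff, mem_ofPred_eq, inner_zero_left, not_forall,
    not_le, EReal.coe_zero] at h
  obtain ⟨v₀, hv₀⟩ := h
  obtain ⟨δ, hδ, B, hB, hdesc⟩ := exists_descentOn_of_clarkeDeriv_neg U hv₀
  obtain ⟨KF, sF, hsF, hKF⟩ := hF hτ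
  obtain ⟨KG, sG, hsG, hKG⟩ := hG hτ
  rw [hU.nhdsWithin_eq hτ] at hsF hsG
  obtain ⟨r, hr, hrs⟩ := Metric.mem_nhds_iff.1 (inter_mem (inter_mem hsF hsG) (hU.mem_nhds hτ))
  -- Changing `v₀` to `v` costs at most `K * dist v v₀ < δ / 4` per unit step, changing `μ` to `ν`
  -- at most `C * |ν - μ| < δ / 4`; rate `δ / 2` remains. The bound `R` on both directions keeps the
  -- segment ends in the ball of radius `r`.
  set K : ℝ := KF + |μ| * KG + 1 with hK
  have hKpos : 0 < K := by positivity
  obtain ⟨v, hvD, hv⟩ := hD.exists_dist_lt v₀ (ε := δ / (4 * K)) (by positivity)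
  set C : ℝ := KG * ‖v‖ + 1 with hC
  have hCpos : 0 < C := by positivity
  set R : ℝ := ‖v‖ + ‖v₀‖ + 1 with hR
  have hRpos : 0 < R := by positivity
  refine ⟨v, hvD, min (δ / 2) (r / (2 * R)), by positivity, B ∩ Metric.ball τ (r / 2),
    inter_mem hB (Metric.ball_mem_nhds _ (by positivity)), Metric.ball μ (δ / (4 * C)),
    Metric.ball_mem_nhds _ (by positivity), fun ν hν => ?_⟩
  rintro ⟨y, t⟩ ⟨⟨⟨hyB, hyr⟩, hyU⟩, ⟨ht0, ht⟩, hyv⟩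
  simp only at hyB hyr hyU ht0 ht hyv ⊢
  have htδ : t < δ / 2 := ht.trans_le (min_le_left _ _)
  have htr : t * (2 * R) < r := by
    rw [← lt_div_iff₀ (by positivity)]; exact ht.trans_le (min_le_right _ _)
  have hball : ∀ w : E, ‖w‖ ≤ R → y + t • w ∈ Metric.ball τ r := by
    intro w hw
    rw [Metric.mem_ball, dist_eq_norm] at hyr ⊢
    have e : y + t • w - τ = (y - τ) + t • w := by abel
    have h1 := norm_add_le (y - τ) (t • w)
    rw [norm_smul, Real.norm_of_nonneg ht0.le] at h1
    have h2 := mul_le_mul_of_nonneg_left hw ht0.le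
    rw [e]; linarith
  have hb0 : y ∈ Metric.ball τ r := by simpa using hball 0 (by simpa using hRpos.le)
  have hb1 := hball v (by rw [hR]; linarith [norm_nonneg v₀])
  have hb2 := hball v₀ (by rw [hR]; linarith [norm_nonneg v])
  have hd := hdesc (y, t) ⟨⟨hyB, hyU⟩, ⟨ht0, by linarith⟩, (hrs hb2).2⟩
  simp only at hd
  have lF := hKF.dist_le_mul _ (hrs hb1).1.1 _ (hrs hb2).1.1
  have lG := hKG.dist_le_mul _ (hrs hb1).1.2 _ (hrs hb2).1.2
  have lG' := hKG.dist_le_mul _ (hrs hb1).1.2 _ (hrs hb0).1.2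
  have d1 : dist (y + t • v) (y + t • v₀) = t * dist v v₀ := by
    rw [dist_add_left, dist_smul₀, Real.norm_of_nonneg ht0.le]
  have d2 : dist (y + t • v) y = t * ‖v‖ := by
    rw [dist_self_add_left, norm_smul, Real.norm_of_nonneg ht0.le]
  rw [d1, Real.dist_eq] at lF lG
  rw [d2, Real.dist_eq] at lG'
  rw [dist_comm] at hv
  rw [lt_div_iff₀ (by positivity)] at hv
  rw [Metric.mem_ball, Real.dist_eq, lt_div_iff₀ (by positivity)] at hν
  simp only [lagrangian] at hd ⊢
  set a := F (y + t • v) z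
  set a₀ := F (y + t • v₀) z
  set b := G (y + t • v) z
  set b₀ := G (y + t • v₀) z
  have q1 : a - a₀ ≤ KF * (t * dist v v₀) := (le_abs_self _).trans lF
  have q2 : μ * (b - b₀) ≤ |μ| * (KG * (t * dist v v₀)) := by
    refine (le_abs_self _).trans ?_
    rw [abs_mul]
    exact mul_le_mul_of_nonneg_left lG (abs_nonneg _)
  have q3 : (ν - μ) * (b - G y z) ≤ |ν - μ| * (KG * (t * ‖v‖)) := by
    refine (le_abs_self _).trans ?_
    rw [abs_mul]
    exact mul_le_mul_of_nonneg_left lG' (abs_nonneg _)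
  have q4 : (KF + |μ| * KG) * (t * dist v v₀) ≤ δ / 4 * t := by
    have : (KF + |μ| * KG) * dist v v₀ ≤ δ / 4 := by
      have := dist_nonneg (x := v) (y := v₀)
      rw [hK] at hv
      linarith
    have := mul_le_mul_of_nonneg_right this ht0.le
    linarith
  have q5 : |ν - μ| * (KG * (t * ‖v‖)) ≤ δ / 4 * t := by
    have : |ν - μ| * (KG * ‖v‖) ≤ δ / 4 := by
      have := abs_nonneg (ν - μ)
      rw [hC] at hν
      linarith
    have := mul_le_mul_of_nonneg_right this ht0.le
    linarith
  have q6 := mul_le_mul_of_nonneg_right (min_le_left (δ / 2) (r / (2 * R))) ht0.le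
  linarith

/-- The samples `z` for which one of the finitely many directions `d k`, `k ∈ V`, is a uniform
descent direction of the Lagrangian near `B`, for every multiplier. -/
def descentSamples (F G : E → Ξ → ℝ) (U : Set E) (μmin μmax : ℝ) (d : ℕ → E) (B : Set E) (δ : ℝ)
    (V : Finset ℕ) : Set Ξ :=
  {z | ∀ μ ∈ Icc μmin μmax, ∃ k ∈ V, DescentOn (fun σ => lagrangian F G σ z μ) U B δ (d k)}

/-- Continuity in the multiplier and in the point and step reduces both uncountable quantifiers to
countable dense sets. -/
theorem measurableSet_descentSamples [FiniteDimensional ℝ E] [MeasurableSpace Ξ]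
    {F G : E → Ξ → ℝ} {U : Set E}
    (hF : ∀ z, ContinuousOn (fun τ => F τ z) U) (hG : ∀ z, ContinuousOn (fun τ => G τ z) U)
    (hFmeas : ∀ τ ∈ U, Measurable (F τ)) (hGmeas : ∀ τ ∈ U, Measurable (G τ)) (μmin μmax : ℝ)
    (d : ℕ → E) (B : Set E) (δ : ℝ) (V : Finset ℕ) :
    MeasurableSet (descentSamples F G U μmin μmax d B δ V) := by
  have : SecondCountableTopology E := secondCountable_of_proper
  refine measurableSet_forall_mem_of_closed (Icc μmin μmax)
    (fun μ z => ∃ k ∈ V, DescentOn (fun σ => lagrangian F G σ z μ) U B δ (d k)) (fun z => ?_)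
    (fun μ _ => ?_)
  · simp only [DescentOn, ← Finset.mem_coe]
    have : {x : Icc μmin μmax | ∃ k ∈ (V : Set ℕ),
        DescentOn (fun σ => lagrangian F G σ z x) U B δ (d k)} = ⋃ k ∈ (V : Set ℕ),
        {x : Icc μmin μmax | DescentOn (fun σ => lagrangian F G σ z x) U B δ (d k)} := by
      ext; simp
    -- Finiteness of `V` keeps the union closed.
    refine this ▸ V.finite_toSet.isClosed_biUnion fun k _ => ?_
    simp only [DescentOn, ofPred_forall, lagrangian]
    refine isClosed_iInter fun p => isClosed_iInter fun _ => isClosed_le ?_ ?_ <;> fun_prop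
  · have : {z | ∃ k ∈ V, DescentOn (fun σ => lagrangian F G σ z μ) U B δ (d k)} =
        ⋃ k ∈ V, {z | DescentOn (fun σ => lagrangian F G σ z μ) U B δ (d k)} := by
      ext; simp
    rw [this]
    refine V.measurableSet_biUnion fun k _ => ?_
    refine measurableSet_forall_mem_of_closed
      {p : E × ℝ | p.1 ∈ B ∩ U ∧ p.2 ∈ Ioo 0 δ ∧ p.1 + p.2 • d k ∈ U} (fun p z =>
        lagrangian F G (p.1 + p.2 • d k) z μ - lagrangian F G p.1 z μ ≤ -(δ * p.2))
      (fun z => ?_) (fun p hp => ?_)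
    · have hL : ContinuousOn (fun σ => lagrangian F G σ z μ) U :=
        (hF z).add (continuousOn_const.mul (hG z))
      refine isClosed_le (Continuous.sub ?_ ?_) (by fun_prop)
      · exact hL.comp_continuous (f := fun p : {p : E × ℝ | p.1 ∈ B ∩ U ∧ p.2 ∈ Ioo 0 δ ∧
          p.1 + p.2 • d k ∈ U} => (p : E × ℝ).1 + (p : E × ℝ).2 • d k) (by fun_prop)
          fun p => p.2.2.2
      · exact hL.comp_continuous (f := fun p : {p : E × ℝ | p.1 ∈ B ∩ U ∧ p.2 ∈ Ioo 0 δ ∧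
          p.1 + p.2 • d k ∈ U} => (p : E × ℝ).1) (by fun_prop) fun p => p.2.1.2
    · have hL : ∀ σ ∈ U, Measurable fun z => lagrangian F G σ z μ := fun σ hσ =>
        (hFmeas σ hσ).add ((hGmeas σ hσ).const_mul μ)
      exact measurableSet_le ((hL _ hp.2.2).sub (hL _ hp.1.2)) measurable_const

theorem multipliers_eq_empty_of_mem_descentSamples {F G : E → Ξ → ℝ} {M U B : Set E}
    (hU : IsOpen U) (hMU : M ⊆ U) (hB : IsOpen B) {μmin μmax : ℝ} {d : ℕ → E} {δ : ℝ} (hδ : 0 < δ)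
    {V : Finset ℕ} {τ : E} (hτ : τ ∈ B) {z : Ξ}
    (hz : z ∈ descentSamples F G U μmin μmax d B δ V) :
    multipliers F G M μmin μmax τ z = ∅ := by
  refine eq_empty_of_forall_notMem fun μ ⟨hμ, h0, hM⟩ => ?_
  obtain ⟨k, -, hk⟩ := hz μ hμ
  exact zero_notMem_clarkeSubdiff_of_descentOn hU hB ⟨hτ, hMU hM⟩ hδ hk h0

theorem exists_mem_descentSamples {F G : E → Ξ → ℝ} {M U : Set E} (hU : IsOpen U) (hMU : M ⊆ U)
    {z : Ξ} (hF : LocallyLipschitzOn U fun τ => F τ z) (hG : LocallyLipschitzOn U fun τ => G τ z)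
    {μmin μmax : ℝ} {d : ℕ → E} (hd : DenseRange d) {τ : E} (hτ : τ ∈ M)
    (h : multipliers F G M μmin μmax τ z = ∅) :
    ∃ B ∈ 𝓝 τ, ∃ δ > 0, ∃ V : Finset ℕ, z ∈ descentSamples F G U μmin μmax d B δ V := by
  classical
  suffices H : ∃ B ∈ 𝓝 τ, ∃ δ > 0, ∃ V : Finset ℕ, ∀ μ ∈ Icc μmin μmax, ∃ k ∈ V,
      DescentOn (fun σ => lagrangian F G σ z μ) U B δ (d k) from H
  -- Compactness induction: a union of two sets of multipliers intersects the neighbourhoods, takes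
  -- the smaller rate and joins the directions.
  refine (isCompact_Icc (a := μmin) (b := μmax)).induction_on (p := fun S => ∃ B ∈ 𝓝 τ, ∃ δ > 0,
    ∃ V : Finset ℕ, ∀ μ ∈ S, ∃ k ∈ V, DescentOn (fun σ => lagrangian F G σ z μ) U B δ (d k))
    ⟨univ, univ_mem, 1, one_pos, ∅, by simp⟩ ?_ ?_ ?_
  · rintro S T hST ⟨B, hB, δ, hδ, V, hV⟩
    exact ⟨B, hB, δ, hδ, V, fun μ hμ => hV μ (hST hμ)⟩
  · rintro S T ⟨B, hB, δ, hδ, V, hV⟩ ⟨B', hB', δ', hδ', V', hV'⟩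
    refine ⟨B ∩ B', inter_mem hB hB', min δ δ', lt_min hδ hδ', V ∪ V', ?_⟩
    rintro μ (hμ | hμ)
    · obtain ⟨k, hk, h⟩ := hV μ hμ
      exact ⟨k, Finset.mem_union_left _ hk, h.mono inter_subset_left (min_le_left _ _)⟩
    · obtain ⟨k, hk, h⟩ := hV' μ hμ
      exact ⟨k, Finset.mem_union_right _ hk, h.mono inter_subset_right (min_le_right _ _)⟩
  · intro μ hμ
    have h0 : (0 : E) ∉ lagrangianSubdiff F G τ z μ := fun h0 => by
      have : μ ∈ multipliers F G M μmin μmax τ z := ⟨hμ, h0, hτ⟩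
      simp [h] at this
    obtain ⟨_, ⟨k, rfl⟩, δ, hδ, B, hB, S, hS, hdesc⟩ :=
      exists_descentOn_lagrangian_nhds hU hF hG hd (hMU hτ) h0
    exact ⟨S, mem_nhdsWithin_of_mem_nhds hS, B, hB, δ, hδ, {k}, fun ν hν =>
      ⟨k, Finset.mem_singleton_self k, hdesc ν hν⟩⟩

/-! ### Multipliers and KKT points. -/

theorem multipliers_nonempty_of_kktMap_nonempty {F G : E → Ξ → ℝ} {M : Set E} {μmin μmax : ℝ}
    {τ : E} {z : Ξ} (h : (kktMap F G M μmin μmax τ z).Nonempty) :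
    (multipliers F G M μmin μmax τ z).Nonempty := by
  by_contra hne
  rw [not_nonempty_iff_eq_empty] at hne
  simp [kktMap, hne] at h

theorem zero_mem_kktMap {F G : E → Ξ → ℝ} {M : Set E} {μmin μmax : ℝ} {τ : E} {z : Ξ}
    (h : (multipliers F G M μmin μmax τ z).Nonempty) : (0 : E) ∈ kktMap F G M μmin μmax τ z := by
  obtain ⟨μ, hμ⟩ := h
  exact subset_convexHull ℝ _ (mem_biUnion hμ hμ.2.1)

/-- A Minkowski sum with an empty summand is empty, so no single sample can lack a multiplier. -/
theorem IsSAAKKTPoint.multipliers_nonempty {F G : E → Ξ → ℝ} {M : Set E} {μmin μmax : ℝ}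
    {s : ℕ → Ξ} {N : ℕ} {τ : E} (h : IsSAAKKTPoint F G M μmin μmax s N τ) {i : ℕ} (hi : i < N) :
    (multipliers F G M μmin μmax τ (s i)).Nonempty := by
  obtain ⟨-, x, ⟨y, hy, -⟩, -⟩ := h
  obtain ⟨g, hg, -⟩ := (Set.mem_finsetSum _ _ _).1 hy
  exact multipliers_nonempty_of_kktMap_nonempty ⟨g i, hg (Finset.mem_range.2 hi)⟩

theorem isWeakKKTPoint_of_ae_multipliers_nonempty [MeasurableSpace Ξ] {P : Measure Ξ}
    {F G : E → Ξ → ℝ} {M : Set E} {μmin μmax : ℝ} {τ : E} (hτ : τ ∈ M)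
    (h : ∀ᵐ z ∂P, (multipliers F G M μmin μmax τ z).Nonempty) :
    IsWeakKKTPoint P F G M μmin μmax τ := by
  refine ⟨hτ, 0, ⟨fun _ => 0, integrable_zero _ _ _, ?_, by simp⟩, 0, fun v _ => by simp, by simp⟩
  exact h.mono fun z hz => zero_mem_kktMap hz

end Descent

/-- An i.i.d. sequence almost surely visits every set of positive probability. -/
theorem ae_exists_mem_of_iIndepFun {Ω Ξ : Type*} [MeasurableSpace Ω] [MeasurableSpace Ξ]
    {Pr : Measure Ω} {P : Measure Ξ} [IsProbabilityMeasure P] {ξ : ℕ → Ω → Ξ}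
    (hξmeas : ∀ i, Measurable (ξ i)) (hξlaw : ∀ i, Measure.map (ξ i) Pr = P)
    (hξindep : iIndepFun ξ Pr) {W : Set Ξ} (hW : MeasurableSet W) (hpos : P W ≠ 0) :
    ∀ᵐ ω ∂Pr, ∃ i, ξ i ω ∈ W := by
  have hlt : P Wᶜ < 1 := by
    rw [prob_compl_eq_one_sub hW]
    exact ENNReal.sub_lt_self ENNReal.one_ne_top one_ne_zero hpos
  -- By independence the first `n` samples all miss `W` with probability `P Wᶜ ^ n`, which tends to
  -- 0.
  have hbound : ∀ n : ℕ, Pr {ω | ¬ ∃ i, ξ i ω ∈ W} ≤ P Wᶜ ^ n := by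
    intro n
    have hprod := hξindep.measure_inter_preimage_eq_mul (Finset.range n) (sets := fun _ => Wᶜ)
      (fun _ _ => hW.compl)
    have hone : ∀ i, Pr (ξ i ⁻¹' Wᶜ) = P Wᶜ := fun i => by
      rw [← hξlaw i, Measure.map_apply (hξmeas i) hW.compl]
    simp only [hone, Finset.prod_const, Finset.card_range] at hprod
    rw [← hprod]
    refine measure_mono fun ω hω => ?_
    simp only [mem_ofPred_eq, not_exists] at hω
    simp [hω]
  exact le_antisymm (ge_of_tendsto' (ENNReal.tendsto_pow_atTop_nhds_zero_of_lt_one hlt) hbound)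
    zero_le

end OuterLoop

theorem theorem7
    {E : Type*} [NormedAddCommGroup E] [InnerProductSpace ℝ E] [FiniteDimensional ℝ E]
    {Ξ : Type*} [MeasurableSpace Ξ] (P : Measure Ξ) [IsProbabilityMeasure P]
    {Ω : Type*} [MeasurableSpace Ω] (Pr : Measure Ω) [IsProbabilityMeasure Pr]
    -- the random cost and constraint functions, defined near the feasible set `M`
    (F G : E → Ξ → ℝ) (M U : Set E) (hU : IsOpen U) (hMU : M ⊆ U)
    (hFlip : ∀ z, LocallyLipschitzOn U (fun τ => F τ z))
    (hGlip : ∀ z, LocallyLipschitzOn U (fun τ => G τ z))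
    (hFmeas : ∀ τ ∈ U, Measurable (F τ)) (hGmeas : ∀ τ ∈ U, Measurable (G τ))
    (μmin μmax : ℝ)
    -- the i.i.d. samples with law `P`
    (ξ : ℕ → Ω → Ξ) (hξmeas : ∀ i, Measurable (ξ i)) (hξlaw : ∀ i, Measure.map (ξ i) Pr = P)
    (hξindep : iIndepFun ξ Pr)
    -- generalized KKT points of the sample-average problems
    (τ : ℕ → Ω → E)
    (hτ : ∀ᵐ ω ∂Pr, ∀ N : ℕ, 1 ≤ N →
      OuterLoop.IsSAAKKTPoint F G M μmin μmax (fun i => ξ i ω) N (τ N ω)) :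
    ∀ᵐ ω ∂Pr, ∀ τstar ∈ M, MapClusterPt τstar atTop (fun N => τ N ω) →
      OuterLoop.IsWeakKKTPoint P F G M μmin μmax τstar := by
  have : SecondCountableTopology E := secondCountable_of_proper
  let d := TopologicalSpace.denseSeq E
  have hd : DenseRange d := TopologicalSpace.denseRange_denseSeq E
  let W (B : Set E) (n : ℕ) (V : Finset ℕ) : Set Ξ :=
    OuterLoop.descentSamples F G U μmin μmax d B (1 / ((n : ℝ) + 1)) V
  have hpos (n : ℕ) : (0 : ℝ) < 1 / ((n : ℝ) + 1) := Nat.one_div_pos_of_nat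
  -- The null set is fixed before `τstar`: countably many triples `(B, n, V)` cover all accumulation
  -- points at once.
  have hvisit : ∀ᵐ ω ∂Pr, ∀ B ∈ TopologicalSpace.countableBasis E, ∀ n V,
      P (W B n V) ≠ 0 → ∃ i, ξ i ω ∈ W B n V := by
    refine (ae_ball_iff (TopologicalSpace.countable_countableBasis E)).2 fun B hB => ?_
    refine ae_all_iff.2 fun n => ae_all_iff.2 fun V => ?_
    by_cases h0 : P (W B n V) = 0
    · exact ae_of_all _ fun _ h => absurd h0 h
    · filter_upwards [OuterLoop.ae_exists_mem_of_iIndepFun hξmeas hξlaw hξindep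
        (OuterLoop.measurableSet_descentSamples (fun z => (hFlip z).continuousOn)
          (fun z => (hGlip z).continuousOn) hFmeas hGmeas μmin μmax d B _ V) h0] with ω h _
      exact h
  filter_upwards [hτ, hvisit] with ω hω hvis τs hτs hclus
  have hnull : ∀ B ∈ TopologicalSpace.countableBasis E, ∀ n V, τs ∈ B → P (W B n V) = 0 := by
    intro B hB n V hτB
    by_contra h0
    obtain ⟨i, hi⟩ := hvis B hB n V h0
    have hBo := TopologicalSpace.isOpen_of_mem_countableBasis hB
    -- `N > i` makes the bad sample `ξ i ω` part of the problem that `τ N ω` solves.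
    obtain ⟨N, hNB, hN⟩ := ((hclus.frequently (hBo.mem_nhds hτB)).and_eventually
      (eventually_gt_atTop i)).exists
    have hne := (hω N (by omega)).multipliers_nonempty hN
    rw [OuterLoop.multipliers_eq_empty_of_mem_descentSamples hU hMU hBo (hpos n) hNB hi] at hne
    exact not_nonempty_empty hne
  refine OuterLoop.isWeakKKTPoint_of_ae_multipliers_nonempty hτs ?_
  have hae : ∀ᵐ z ∂P, ∀ B ∈ TopologicalSpace.countableBasis E, ∀ n V, τs ∈ B → z ∉ W B n V := by
    refine (ae_ball_iff (TopologicalSpace.countable_countableBasis E)).2 fun B hB => ?_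
    refine ae_all_iff.2 fun n => ae_all_iff.2 fun V => ?_
    by_cases hτB : τs ∈ B
    · filter_upwards [measure_eq_zero_iff_ae_notMem.1 (hnull B hB n V hτB)] with z hz _
      exact hz
    · exact ae_of_all _ fun _ h => absurd h hτB
  filter_upwards [hae] with z hz
  by_contra hne
  obtain ⟨B, hB, δ, hδ, V, hV⟩ := OuterLoop.exists_mem_descentSamples hU hMU (hFlip z) (hGlip z)
    hd hτs (not_nonempty_iff_eq_empty.1 hne)
  -- Shrinking the neighbourhood to a basis set and the rate to `1 / (n + 1)` lands in the countable
  -- family.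
  obtain ⟨B', hB', hτB', hsub⟩ :=
    (TopologicalSpace.isBasis_countableBasis E).mem_nhds_iff.1 hB
  obtain ⟨n, hn⟩ := exists_nat_one_div_lt hδ
  refine hz B' hB' n V hτB' fun μ hμ => ?_
  obtain ⟨k, hk, hdesc⟩ := hV μ hμ
  exact ⟨k, hk, hdesc.mono hsub hn.le⟩
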